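/- For $n\ge 5$, the combinatorial Löbell polyhedron has $2n+2$ faces: a top $n$-gon, a bottom $n$-gon, and $2n$ lateral pentagons $U_i, W_i$ ($i\in\mathbb{Z}/n$), where $U_i$ is adjacent to the top face, to $U_{i-1},U_{i+1}$ and to $W_i,W_{i+1}$, and $W_i$ is adjacent to the bottom face, to $W_{i-1},W_{i+1}$ and to $U_{i-1},U_i$; its vertices are the points where three pairwise adjacent faces meet. For each $n\ge 5$ let $L_n\subset\mathbb{H}^3$ be a compact right-angled polyhedron of this combinatorial type (a Löbell polyhedron), let $\Gamma_n<\mathrm{Isom}(\mathbb{H}^3)$ be the group generated by the reflections in the faces of $L_n$, and call $\mathbb{H}^3/\Gamma_n$ the $n$-th Löbell orbifold. For a subgroup $\Lambda<\mathrm{Isom}(\mathbb{H}^3)$, the translation length of $g\in\Lambda$ is $\inf_{x\in\mathbb{H}^3}\rho(x,gx)$, where $\rho$ is the hyperbolic distance; $g$ is loxodromic if this infimum is positive and attained; and the systole of $\mathbb{H}^3/\Lambda$ is the infimum of the translation lengths of the loxodromic elements of $\Lambda$ (a minimum if $\Lambda$ is a lattice). Corollary 1.3. For each $n\ge 5$ let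 $M_n=\mathbb{H}^3/\Lambda_n$ be a manifold cover of the Löbell orbifold $\mathbb{H}^3/\Gamma_n$ of finite degree, that is, let $\Lambda_n$ be a torsion-free subgroup of finite index in $\Gamma_n$. If the degrees $[\Gamma_n:\Lambda_n]$ are bounded by a constant independent of $n$ (for instance, if all of them equal $8$), then the systole of $M_n$ tends to $0$ as $n\to\infty$. -/

import Mathlib

open Filter Topology
open scoped ENNReal

noncomputable section

/-! ### Hyperbolic 3-space in the hyperboloid model -/

/-- The Lorentzian scalar product of signature `(3,1)` on `ℝ⁴`. -/
def lorentz (x y : Fin 4 → ℝ) : ℝ :=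
  -(x 0 * y 0) + x 1 * y 1 + x 2 * y 2 + x 3 * y 3

/-- Hyperbolic 3-space: the upper sheet of the two-sheeted hyperboloid. -/
def Hyp3 : Set (Fin 4 → ℝ) := {x | lorentz x x = -1 ∧ 0 < x 0}

/-- The hyperbolic distance `ρ`, given by `cosh ρ(x, y) = -(x, y)`. -/
def hdist (x y : Fin 4 → ℝ) : ℝ := Real.arcosh (-lorentz x y)

/-- The isometry group of hyperbolic 3-space, as the group of the linear automorphisms of `ℝ⁴`
that preserve the Lorentzian scalar product and the upper sheet of the hyperboloid. -/
def HypIsom : Subgroup ((Fin 4 → ℝ) ≃ₗ[ℝ] (Fin 4 → ℝ)) where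
  carrier := {g | (∀ x y, lorentz (g x) (g y) = lorentz x y) ∧ ∀ x, g x ∈ Hyp3 ↔ x ∈ Hyp3}
  mul_mem' := by
    rintro a b ⟨ha, ha'⟩ ⟨hb, hb'⟩
    exact ⟨fun x y => by simp [ha, hb], fun x => by simp [ha', hb']⟩
  one_mem' := ⟨fun _ _ => rfl, fun _ => Iff.rfl⟩
  inv_mem' := by
    rintro a ⟨ha, ha'⟩
    have key : ∀ x, a (a⁻¹ x) = x := fun x => a.apply_symm_apply x
    refine ⟨fun x y => ?_, fun x => ?_⟩
    · rw [← ha, key, key]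
    · rw [← ha', key]

/-- The linear reflection `x ↦ x - 2 (x, v) v` for a vector `v` with `(v, v) = 1`. -/
def linReflection (v : Fin 4 → ℝ) (hv : lorentz v v = 1) : (Fin 4 → ℝ) ≃ₗ[ℝ] (Fin 4 → ℝ) :=
  LinearEquiv.ofInvolutive
    { toFun := fun x => x - (2 * lorentz x v) • v
      map_add' := fun x y => by
        ext i; simp [lorentz]; ring
      map_smul' := fun c x => by
        ext i; simp [lorentz]; ring }
    (fun x => by
      have h : lorentz (x - (2 * lorentz x v) • v) v = - lorentz x v := by
        have : lorentz (x - (2 * lorentz x v) • v) v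
            = lorentz x v - 2 * lorentz x v * lorentz v v := by
          simp only [lorentz, Pi.sub_apply, Pi.smul_apply, smul_eq_mul]; ring
        rw [this, hv]; ring
      change (x - (2 * lorentz x v) • v)
        - (2 * lorentz (x - (2 * lorentz x v) • v) v) • v = x
      rw [h]; ext i; simp)

theorem linReflection_apply (v : Fin 4 → ℝ) (hv : lorentz v v = 1) (x : Fin 4 → ℝ) :
    linReflection v hv x = x - (2 * lorentz x v) • v := rfl

theorem lorentz_linReflection (v : Fin 4 → ℝ) (hv : lorentz v v = 1) (x y : Fin 4 → ℝ) :
    lorentz (linReflection v hv x) (linReflection v hv y) = lorentz x y := by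
  have : lorentz (linReflection v hv x) (linReflection v hv y)
      = lorentz x y + 4 * lorentz x v * lorentz y v * (lorentz v v - 1) := by
    simp only [linReflection_apply, lorentz, Pi.sub_apply, Pi.smul_apply, smul_eq_mul]; ring
  rw [this, hv]; ring

theorem linReflection_mem_Hyp3 (v : Fin 4 → ℝ) (hv : lorentz v v = 1) (x : Fin 4 → ℝ)
    (hx : x ∈ Hyp3) : linReflection v hv x ∈ Hyp3 := by
  obtain ⟨h1, h0⟩ := hx
  refine ⟨by rw [lorentz_linReflection, h1], ?_⟩
  have hy : lorentz (linReflection v hv x) (linReflection v hv x) = -1 := by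
    rw [lorentz_linReflection, h1]
  have hxy : lorentz x (linReflection v hv x) = -1 - 2 * lorentz x v ^ 2 := by
    have : lorentz x (linReflection v hv x) = lorentz x x - 2 * lorentz x v ^ 2 := by
      simp only [linReflection_apply, lorentz, Pi.sub_apply, Pi.smul_apply, smul_eq_mul]; ring
    rw [this, h1]
  generalize linReflection v hv x = y at hy hxy
  by_contra hneg
  have hneg' : y 0 ≤ 0 := not_lt.mp hneg
  have hneg2 : lorentz x y ≤ -1 := by nlinarith [sq_nonneg (lorentz x v)]
  simp only [lorentz] at h1 hy hneg2
  -- the spatial scalar product is `≤ -1 + x₀ y₀`, which contradicts Cauchy-Schwarz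
  have hcs : (x 1 * y 1 + x 2 * y 2 + x 3 * y 3) ^ 2
      ≤ (x 1 ^ 2 + x 2 ^ 2 + x 3 ^ 2) * (y 1 ^ 2 + y 2 ^ 2 + y 3 ^ 2) := by
    nlinarith [sq_nonneg (x 1 * y 2 - x 2 * y 1), sq_nonneg (x 1 * y 3 - x 3 * y 1),
      sq_nonneg (x 2 * y 3 - x 3 * y 2)]
  have hX : x 1 ^ 2 + x 2 ^ 2 + x 3 ^ 2 = x 0 ^ 2 - 1 := by linarith
  have hY : y 1 ^ 2 + y 2 ^ 2 + y 3 ^ 2 = y 0 ^ 2 - 1 := by linarith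
  rw [hX, hY] at hcs
  have hp : x 0 * y 0 ≤ 0 := mul_nonpos_of_nonneg_of_nonpos h0.le hneg'
  nlinarith [sq_nonneg (x 0), sq_nonneg (y 0), sq_nonneg (x 0 + y 0), sq_nonneg (x 0 - y 0)]

/-- The reflection of hyperbolic 3-space in the plane orthogonal to `v`. -/
def hypReflection (v : Fin 4 → ℝ) (hv : lorentz v v = 1) : HypIsom :=
  ⟨linReflection v hv, lorentz_linReflection v hv, fun x =>
    ⟨fun h => by
      have := linReflection_mem_Hyp3 v hv _ h
      rwa [show linReflection v hv (linReflection v hv x) = x from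
        (linReflection v hv).symm_apply_apply x] at this,
     linReflection_mem_Hyp3 v hv x⟩⟩

/-! ### Translation lengths and systoles -/

/-- The translation length of an isometry `g`: the infimum of `ρ(x, g x)` over hyperbolic space. -/
def translationLength (g : HypIsom) : ℝ := ⨅ x : Hyp3, hdist x (g.1 x)

/-- An isometry is loxodromic if its translation length is positive and attained. -/
def IsLoxodromic (g : HypIsom) : Prop :=
  0 < translationLength g ∧ ∃ x ∈ Hyp3, hdist x (g.1 x) = translationLength g

/-- The systole of `Λ`, that is, of the orbifold `ℍ³/Λ`: the infimum of the translation lengths of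
the loxodromic elements of `Λ` (and `∞` if there are none). -/
def systole (Λ : Subgroup HypIsom) : ℝ≥0∞ :=
  ⨅ g ∈ {g : HypIsom | g ∈ Λ ∧ IsLoxodromic g}, ENNReal.ofReal (translationLength g)

/-! ### Polyhedra in hyperbolic 3-space -/

/-- The intersection of the half-spaces `(x, v i) ≤ 0` of hyperbolic 3-space. -/
def polyhedron {ι : Type} (v : ι → Fin 4 → ℝ) : Set (Fin 4 → ℝ) :=
  {x | x ∈ Hyp3 ∧ ∀ i, lorentz x (v i) ≤ 0}

/-- The face of the polyhedron on the plane orthogonal to `v i`. -/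
def polyhedronFace {ι : Type} (v : ι → Fin 4 → ℝ) (i : ι) : Set (Fin 4 → ℝ) :=
  {x | x ∈ polyhedron v ∧ lorentz x (v i) = 0}

/-- The vectors `v i` are the outward unit normals of the (pairwise different) two-dimensional
faces of a compact polyhedron with nonempty interior. -/
structure IsCompactPolyhedron {ι : Type} (v : ι → Fin 4 → ℝ) : Prop where
  unit : ∀ i, lorentz (v i) (v i) = 1
  compact : IsCompact (polyhedron v)
  interior : ∃ x ∈ Hyp3, ∀ i, lorentz x (v i) < 0
  /-- No half-space can be left out. -/
  irredundant : ∀ i, ∃ x ∈ Hyp3, 0 < lorentz x (v i) ∧ ∀ j, j ≠ i → lorentz x (v j) ≤ 0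

/-- All dihedral angles are `π/2`: two different faces with a common edge (that is, with more than
one common point) lie on orthogonal planes. -/
def IsRightAngled {ι : Type} (v : ι → Fin 4 → ℝ) : Prop :=
  ∀ i j, i ≠ j → (polyhedronFace v i ∩ polyhedronFace v j).Nontrivial → lorentz (v i) (v j) = 0

/-- The group generated by the reflections in the faces of the polyhedron. -/
def reflectionGroup {ι : Type} (v : ι → Fin 4 → ℝ) : Subgroup HypIsom :=
  Subgroup.closure {g | ∃ i, ∃ h : lorentz (v i) (v i) = 1, g = hypReflection (v i) h}

/-! ### Löbell polyhedra -/

/-- The faces of the combinatorial Löbell polyhedron: two `n`-gons, and two cyclic rows of `n`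
pentagons each. -/
inductive LobellFace (n : ℕ) : Type
  | top : LobellFace n
  | bottom : LobellFace n
  | upper : ZMod n → LobellFace n
  | lower : ZMod n → LobellFace n

/-- The vertices of the combinatorial Löbell polyhedron, each given as the set of the three faces
that meet there. The pentagon `upper i` is adjacent to `top`, `upper (i - 1)`, `upper (i + 1)`,
`lower i` and `lower (i + 1)`; the pentagon `lower i` is adjacent to `bottom`, `lower (i - 1)`,
`lower (i + 1)`, `upper (i - 1)` and `upper i`. -/
inductive IsLobellVertex (n : ℕ) : Set (LobellFace n) → Prop
  | top (i : ZMod n) :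
      IsLobellVertex n {LobellFace.top, LobellFace.upper i, LobellFace.upper (i + 1)}
  | upper (i : ZMod n) :
      IsLobellVertex n {LobellFace.upper i, LobellFace.upper (i + 1), LobellFace.lower (i + 1)}
  | lower (i : ZMod n) :
      IsLobellVertex n {LobellFace.upper i, LobellFace.lower i, LobellFace.lower (i + 1)}
  | bottom (i : ZMod n) :
      IsLobellVertex n {LobellFace.bottom, LobellFace.lower i, LobellFace.lower (i + 1)}

/-- The polyhedron with face normals `v` has the combinatorial type of the Löbell polyhedron, the
face with normal `v F` corresponding to `F`: a set of faces has a common point if and only if the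
faces in it meet at a common vertex of the combinatorial Löbell polyhedron. The maximal
such sets are the sets of faces through the single vertices, so this says that the two polyhedra
have the same incidences of vertices and faces. -/
def HasLobellType (n : ℕ) (v : LobellFace n → Fin 4 → ℝ) : Prop :=
  ∀ S : Set (LobellFace n),
    (∃ x ∈ polyhedron v, ∀ F ∈ S, x ∈ polyhedronFace v F) ↔ ∃ W, IsLobellVertex n W ∧ S ⊆ W

/-- The vectors `v F` are the outward unit normals of the faces of a compact right-angled
polyhedron in hyperbolic 3-space of the combinatorial type of the Löbell polyhedron `L_n`. -/
structure IsLobellPolyhedron (n : ℕ) (v : LobellFace n → Fin 4 → ℝ) : Prop where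
  isCompactPolyhedron : IsCompactPolyhedron v
  isRightAngled : IsRightAngled v
  hasLobellType : HasLobellType n v

/-- `ℍ³/Λ` is a manifold cover of the orbifold `ℍ³/Γ` of finite degree at most `D`: `Λ` is a
torsion-free subgroup of `Γ`, of finite index at most `D`. -/
structure IsManifoldCoverOfDegreeLE (Λ Γ : Subgroup HypIsom) (D : ℕ) : Prop where
  le : Λ ≤ Γ
  torsionFree : ∀ g ∈ Λ, g ≠ 1 → ¬ IsOfFinOrder g
  finiteDegree : Λ.relIndex Γ ≠ 0
  degree_le : Λ.relIndex Γ ≤ D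

end

/-!
The top and the bottom of a Löbell polyhedron with many faces are close to each other. If `d` is the
length of their common perpendicular, the product of the reflections in them is a translation of
length `2 d`, and a subgroup of index at most `D` contains the `k`-th power of it for some
`1 ≤ k ≤ D`, a loxodromic element of translation length `2 k d` (`systole_le_of_reflections`). So it
remains to show that `d` tends to `0`. No symmetry of the polyhedron, and hence no rigidity theorem,
is needed for that.

* Two faces of a Löbell polyhedron are orthogonal or disjoint. The projection to the plane of a face
  therefore takes the polyhedron into that face (`exists_smul_sub_mem_polyhedronFace`), so a closest
  pair of points of two disjoint faces spans a common perpendicular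
  (`exists_common_perpendicular`). In particular the products of different normals are nonpositive,
  and top and bottom have a common perpendicular with feet `x` and `y` in these faces.
* Unit spacelike vectors with pairwise nonpositive products are separated from each other. Hence the
  number of faces at bounded distance from a point is bounded independently of `n`
  (`exists_card_le_of_lorentz_le`). If `n` is large, there is an `i` such that `U_i` is far from `x`
  and `W_i` is far from `y`.
* `U_i` is orthogonal to the top, `W_i` to the bottom, and they are orthogonal to each other. By the
  Cauchy-Schwarz inequality in the orthogonal complement of the common perpendicular,
  `(cosh d)² ≤ (1 + A⁻²) (1 + B⁻²)`, where `A = -(x, U_i)` and `B = -(y, W_i)` are large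
  (`cosh_mul_sq_le`).
-/

/-! ### Lorentzian linear algebra -/

theorem lorentz_comm (x y : Fin 4 → ℝ) : lorentz x y = lorentz y x := by
  simp only [lorentz]; ring

theorem lorentz_add_left (x y z : Fin 4 → ℝ) :
    lorentz (x + y) z = lorentz x z + lorentz y z := by
  simp only [lorentz, Pi.add_apply]; ring

theorem lorentz_sub_left (x y z : Fin 4 → ℝ) :
    lorentz (x - y) z = lorentz x z - lorentz y z := by
  simp only [lorentz, Pi.sub_apply]; ring

theorem lorentz_smul_left (c : ℝ) (x z : Fin 4 → ℝ) : lorentz (c • x) z = c * lorentz x z := by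
  simp only [lorentz, Pi.smul_apply, smul_eq_mul]; ring

theorem lorentz_add_right (x y z : Fin 4 → ℝ) :
    lorentz z (x + y) = lorentz z x + lorentz z y := by
  simp only [lorentz, Pi.add_apply]; ring

theorem lorentz_sub_right (x y z : Fin 4 → ℝ) :
    lorentz z (x - y) = lorentz z x - lorentz z y := by
  simp only [lorentz, Pi.sub_apply]; ring

theorem lorentz_smul_right (c : ℝ) (x z : Fin 4 → ℝ) : lorentz z (c • x) = c * lorentz z x := by
  simp only [lorentz, Pi.smul_apply, smul_eq_mul]; ring

theorem continuous_lorentz : Continuous fun p : (Fin 4 → ℝ) × (Fin 4 → ℝ) => lorentz p.1 p.2 := by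
  unfold lorentz; fun_prop

/-- The spatial coordinates of `z` after the Lorentz boost that takes the point `x` of hyperbolic
space to `(1, 0, 0, 0)`. -/
noncomputable def boostCoord (x z : Fin 4 → ℝ) (k : Fin 3) : ℝ :=
  z k.succ - x k.succ * z 0 +
    x k.succ * ((x 1 * z 1 + x 2 * z 2 + x 3 * z 3) / (1 + x 0))

theorem boostCoord_sub (x z w : Fin 4 → ℝ) (k : Fin 3) :
    boostCoord x (z - w) k = boostCoord x z k - boostCoord x w k := by
  simp only [boostCoord, Pi.sub_apply]; ring

/-- The time coordinate of `z` after the boost is `-(z, x)`. -/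
theorem sum_boostCoord_mul {x : Fin 4 → ℝ} (hx : x ∈ Hyp3) (z w : Fin 4 → ℝ) :
    ∑ k, boostCoord x z k * boostCoord x w k = lorentz z w + lorentz z x * lorentz w x := by
  obtain ⟨h1, h0⟩ := hx
  have hne : (1 + x 0) ≠ 0 := by positivity
  simp only [lorentz] at h1
  simp only [Fin.sum_univ_three, boostCoord, lorentz]
  change (z 1 - x 1 * z 0 + x 1 * _) * (w 1 - x 1 * w 0 + x 1 * _)
    + (z 2 - x 2 * z 0 + x 2 * _) * (w 2 - x 2 * w 0 + x 2 * _)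
    + (z 3 - x 3 * z 0 + x 3 * _) * (w 3 - x 3 * w 0 + x 3 * _) = _
  generalize hp : (x 1 * z 1 + x 2 * z 2 + x 3 * z 3) / (1 + x 0) = p
  generalize hq : (x 1 * w 1 + x 2 * w 2 + x 3 * w 3) / (1 + x 0) = q
  rw [div_eq_iff hne] at hp hq
  linear_combination (p - z 0) * (q - w 0) * h1 +
    (q - w 0 - (x 1 * w 1 + x 2 * w 2 + x 3 * w 3) + x 0 * w 0) * hp +
    (p - z 0 - p * (1 + x 0) + x 0 * z 0) * hq

theorem lorentz_self_add_sq_nonneg {x : Fin 4 → ℝ} (hx : x ∈ Hyp3) (z : Fin 4 → ℝ) :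
    0 ≤ lorentz z z + lorentz z x ^ 2 := by
  rw [sq, ← sum_boostCoord_mul hx]
  exact Finset.sum_nonneg fun k _ => mul_self_nonneg _

/-- The Cauchy-Schwarz inequality for the form `(z, w) + (z, x) (w, x)`, which is the pullback of the
Euclidean scalar product of `xᗮ` under the orthogonal projection. -/
theorem lorentz_cauchySchwarz {x : Fin 4 → ℝ} (hx : x ∈ Hyp3) (z w : Fin 4 → ℝ) :
    (lorentz z w + lorentz z x * lorentz w x) ^ 2 ≤
      (lorentz z z + lorentz z x ^ 2) * (lorentz w w + lorentz w x ^ 2) := by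
  rw [sq (lorentz z x), sq (lorentz w x), ← sum_boostCoord_mul hx, ← sum_boostCoord_mul hx,
    ← sum_boostCoord_mul hx]
  simpa only [sq] using Finset.sum_mul_sq_le_sq_mul_sq Finset.univ (boostCoord x z) (boostCoord x w)

/-- The product of two future timelike vectors is negative. -/
theorem lorentz_neg_of_timelike {x y : Fin 4 → ℝ} (hx : lorentz x x < 0) (hx0 : 0 < x 0)
    (hy : lorentz y y < 0) (hy0 : 0 < y 0) : lorentz x y < 0 := by
  simp only [lorentz] at *
  have hcs : (x 1 * y 1 + x 2 * y 2 + x 3 * y 3) ^ 2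
      ≤ (x 1 ^ 2 + x 2 ^ 2 + x 3 ^ 2) * (y 1 ^ 2 + y 2 ^ 2 + y 3 ^ 2) := by
    nlinarith [sq_nonneg (x 1 * y 2 - x 2 * y 1), sq_nonneg (x 1 * y 3 - x 3 * y 1),
      sq_nonneg (x 2 * y 3 - x 3 * y 2)]
  have h : (x 1 * y 1 + x 2 * y 2 + x 3 * y 3) ^ 2 < (x 0 * y 0) ^ 2 := by
    refine hcs.trans_lt ?_
    rw [mul_pow]
    exact mul_lt_mul'' (by linarith) (by linarith) (by positivity) (by positivity)
  have := lt_of_pow_lt_pow_left₀ 2 (by positivity) h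
  linarith

theorem pos_of_lorentz_neg {x y : Fin 4 → ℝ} (hx : x ∈ Hyp3) (hy : lorentz y y < 0)
    (hxy : lorentz x y < 0) : 0 < y 0 := by
  by_contra! h
  rcases h.lt_or_eq with h | h
  · have := lorentz_neg_of_timelike (x := x) (y := (-1 : ℝ) • y) (by linarith [hx.1]) hx.2
      (by rw [lorentz_smul_left, lorentz_smul_right]; linarith) (by simpa using h)
    rw [lorentz_smul_right] at this
    linarith
  · simp only [lorentz, h] at hy
    nlinarith [sq_nonneg (y 1), sq_nonneg (y 2), sq_nonneg (y 3)]

theorem lorentz_neg_of_mem_Hyp3 {x y : Fin 4 → ℝ} (hx : x ∈ Hyp3) (hy : y ∈ Hyp3) :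
    lorentz x y < 0 :=
  lorentz_neg_of_timelike (by linarith [hx.1]) hx.2 (by linarith [hy.1]) hy.2

theorem eq_of_neg_one_le_lorentz {x y : Fin 4 → ℝ} (hx : x ∈ Hyp3) (hy : y ∈ Hyp3)
    (h : -1 ≤ lorentz x y) : x = y := by
  have h1 := lorentz_neg_of_mem_Hyp3 hx hy
  have h2 := lorentz_self_add_sq_nonneg hx y
  rw [hy.1, lorentz_comm] at h2
  have h3 : lorentz x y = -1 := by nlinarith
  -- `x - y` is lightlike and orthogonal to `x`, so it vanishes
  have hz : lorentz (x - y) (x - y) = 0 := by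
    rw [lorentz_sub_left, lorentz_sub_right, lorentz_sub_right, lorentz_comm y x, hx.1, hy.1, h3]
    ring
  have hxz : lorentz x (x - y) = 0 := by rw [lorentz_sub_right, hx.1, h3]; ring
  have hx1 := hx.1
  rw [← sub_eq_zero]
  generalize x - y = z at hz hxz
  simp only [lorentz] at hz hxz hx1
  have hcs : (x 1 * z 1 + x 2 * z 2 + x 3 * z 3) ^ 2
      ≤ (x 1 ^ 2 + x 2 ^ 2 + x 3 ^ 2) * (z 1 ^ 2 + z 2 ^ 2 + z 3 ^ 2) := by
    nlinarith [sq_nonneg (x 1 * z 2 - x 2 * z 1), sq_nonneg (x 1 * z 3 - x 3 * z 1),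
      sq_nonneg (x 2 * z 3 - x 3 * z 2)]
  rw [show x 1 * z 1 + x 2 * z 2 + x 3 * z 3 = x 0 * z 0 by linarith,
    show x 1 ^ 2 + x 2 ^ 2 + x 3 ^ 2 = x 0 ^ 2 - 1 by linarith,
    show z 1 ^ 2 + z 2 ^ 2 + z 3 ^ 2 = z 0 ^ 2 by linarith] at hcs
  have hz0 : z 0 ^ 2 = 0 := le_antisymm (by nlinarith) (sq_nonneg _)
  have hz1 : z 1 ^ 2 = 0 := by nlinarith [sq_nonneg (z 1), sq_nonneg (z 2), sq_nonneg (z 3)]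
  have hz2 : z 2 ^ 2 = 0 := by nlinarith [sq_nonneg (z 1), sq_nonneg (z 2), sq_nonneg (z 3)]
  have hz3 : z 3 ^ 2 = 0 := by nlinarith [sq_nonneg (z 1), sq_nonneg (z 2), sq_nonneg (z 3)]
  ext k
  fin_cases k
  exacts [pow_eq_zero_iff two_ne_zero |>.mp hz0, pow_eq_zero_iff two_ne_zero |>.mp hz1,
    pow_eq_zero_iff two_ne_zero |>.mp hz2, pow_eq_zero_iff two_ne_zero |>.mp hz3]

theorem exists_smul_mem_Hyp3 {y : Fin 4 → ℝ} (hy : lorentz y y < 0) (hy0 : 0 < y 0) :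
    ∃ c : ℝ, 0 < c ∧ c ^ 2 * lorentz y y = -1 ∧ c • y ∈ Hyp3 := by
  have hs : 0 < √(-lorentz y y) := Real.sqrt_pos.mpr (by linarith)
  have hc : (√(-lorentz y y))⁻¹ ^ 2 * lorentz y y = -1 := by
    rw [inv_pow, Real.sq_sqrt (by linarith), inv_neg, neg_mul, inv_mul_cancel₀ hy.ne]
  refine ⟨(√(-lorentz y y))⁻¹, by positivity, hc, ?_, ?_⟩
  · rw [lorentz_smul_left, lorentz_smul_right, ← mul_assoc, ← sq, hc]
  · simpa using mul_pos (inv_pos.mpr hs) hy0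

/-! ### Planes near a point -/

/-- Only boundedly many planes pass at bounded distance from a point if their unit normals have
pairwise nonpositive products; the bound does not depend on the point. -/
theorem exists_card_le_of_lorentz_le (K : ℝ) : ∃ N : ℕ, ∀ (ι : Type) (s : Finset ι)
    (u : ι → Fin 4 → ℝ) (x : Fin 4 → ℝ), x ∈ Hyp3 → (∀ i, lorentz (u i) (u i) = 1) →
    (∀ i j, i ≠ j → lorentz (u i) (u j) ≤ 0) → (∀ i ∈ s, |lorentz (u i) x| ≤ K) →
    s.card ≤ N := by
  let M : ℤ := ⌈2 * (1 + |K|)⌉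
  refine ⟨(Fintype.piFinset fun _ : Fin 3 => Finset.Icc (-M) M).card,
    fun ι s u x hx h1 h2 hK => ?_⟩
  refine Finset.card_le_card_of_injOn (fun i k => ⌊2 * boostCoord x (u i) k⌋) ?_ ?_
  · intro i hi
    rw [Finset.mem_coe, Fintype.mem_piFinset]
    intro k
    have hsum := sum_boostCoord_mul hx (u i) (u i)
    have hk := Finset.single_le_sum (f := fun k => boostCoord x (u i) k * boostCoord x (u i) k)
      (fun k _ => mul_self_nonneg _) (Finset.mem_univ k)
    have hi := (hK i hi).trans (le_abs_self K)
    have hb : |boostCoord x (u i) k| ≤ 1 + |K| := by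
      refine abs_le_of_sq_le_sq ?_ (by positivity)
      have : lorentz (u i) x ^ 2 ≤ |K| ^ 2 := by rw [← sq_abs]; gcongr
      rw [h1] at hsum
      nlinarith [abs_nonneg K]
    have hM := Int.le_ceil (2 * (1 + |K|))
    obtain ⟨hb1, hb2⟩ := abs_le.mp hb
    rw [Finset.mem_Icc, Int.le_floor]
    refine ⟨?_, ?_⟩
    · push_cast; linarith
    · exact (Int.floor_mono (by linarith)).trans (Int.floor_le_ceil _)
  · -- for two different normals `z = u i - u j` has `(z, z) ≥ 2`, but if both lie in a common
    -- cell of side length `1 / 2`, then `(z, z) ≤ 3 / 4`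
    intro i hi j hj hij
    by_contra hne
    have hsum := sum_boostCoord_mul hx (u i - u j) (u i - u j)
    have hcell : ∀ k, boostCoord x (u i - u j) k * boostCoord x (u i - u j) k ≤ 1 / 4 := by
      intro k
      have := abs_lt.mp (Int.abs_sub_lt_one_of_floor_eq_floor (congrFun hij k))
      rw [boostCoord_sub]
      nlinarith
    have hle := Finset.sum_le_sum fun k (_ : k ∈ Finset.univ) => hcell k
    rw [hsum] at hle
    norm_num at hle
    rw [lorentz_sub_left, lorentz_sub_right, lorentz_sub_right, h1, h1, lorentz_comm (u j)] at hle
    nlinarith [h2 i j hne, mul_self_nonneg (lorentz (u i - u j) x)]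

/-! ### Common perpendiculars of disjoint faces -/

/-- If every face is orthogonal to the face `F` or disjoint from it, then the orthogonal projection
to the plane of `F` takes the polyhedron to `F`. -/
theorem exists_smul_sub_mem_polyhedronFace {ι : Type} [Finite ι] {v : ι → Fin 4 → ℝ} {F : ι}
    (hF : lorentz (v F) (v F) = 1) (hne : (polyhedronFace v F).Nonempty)
    (hd : ∀ G, G ≠ F → lorentz (v G) (v F) = 0 ∨ Disjoint (polyhedronFace v F) (polyhedronFace v G))
    {y : Fin 4 → ℝ} (hy : y ∈ polyhedron v) :
    ∃ c : ℝ, 0 < c ∧ c ^ 2 * (1 + lorentz y (v F) ^ 2) = 1 ∧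
      c • (y - lorentz y (v F) • v F) ∈ polyhedronFace v F := by
  obtain ⟨p, ⟨hpH, hpL⟩, hpF⟩ := hne
  set z := y - lorentz y (v F) • v F with hz
  have hzF : lorentz z (v F) = 0 := by
    rw [hz, lorentz_sub_left, lorentz_smul_left, hF]; ring
  have hzz : lorentz z z = -(1 + lorentz y (v F) ^ 2) := by
    simp only [hz, lorentz_sub_left, lorentz_sub_right, lorentz_smul_left, lorentz_smul_right, hF,
      hy.1.1, lorentz_comm (v F) y]
    ring
  have hzneg : lorentz z z < 0 := by rw [hzz]; nlinarith [sq_nonneg (lorentz y (v F))]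
  have hpz : lorentz p z < 0 := by
    rw [hz, lorentz_sub_right, lorentz_smul_right, hpF]
    linarith [lorentz_neg_of_mem_Hyp3 hpH hy.1]
  have hz0 := pos_of_lorentz_neg hpH hzneg hpz
  -- the segment from a point `p` of the face `F` to `z`
  let w : ℝ → Fin 4 → ℝ := fun s => (1 - s) • p + s • z
  have hw : ∀ s u, lorentz (w s) u = (1 - s) * lorentz p u + s * lorentz z u := fun s u => by
    simp only [w, lorentz_add_left, lorentz_smul_left]
  have hwF : ∀ s, lorentz (w s) (v F) = 0 := fun s => by rw [hw, hpF, hzF]; ring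
  have hwneg : ∀ s ∈ Set.Icc (0 : ℝ) 1, lorentz (w s) (w s) < 0 := by
    rintro s ⟨hs0, hs1⟩
    rw [hw, lorentz_comm p, lorentz_comm z, hw, hw, hpH.1, lorentz_comm z p]
    rcases hs0.eq_or_lt with rfl | hs0
    · norm_num
    · nlinarith [mul_pos hs0 hs0, mul_nonneg (sub_nonneg.mpr hs1) hs0.le, sq_nonneg (1 - s)]
  have hw0 : ∀ s ∈ Set.Icc (0 : ℝ) 1, 0 < w s 0 := by
    rintro s ⟨hs0, hs1⟩
    simp only [w, Pi.add_apply, Pi.smul_apply, smul_eq_mul]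
    rcases hs0.eq_or_lt with rfl | hs0
    · simpa using hpH.2
    · nlinarith [mul_pos hs0 hz0, mul_nonneg (sub_nonneg.mpr hs1) hpH.2.le]
  have hface : ∀ s ∈ Set.Icc (0 : ℝ) 1, (∀ G, lorentz (w s) (v G) ≤ 0) → ∃ c : ℝ, 0 < c ∧
      c ^ 2 * lorentz (w s) (w s) = -1 ∧ c • w s ∈ polyhedronFace v F := by
    intro s hs hle
    obtain ⟨c, hc, hc1, hcH⟩ := exists_smul_mem_Hyp3 (hwneg s hs) (hw0 s hs)
    refine ⟨c, hc, hc1, ⟨hcH, fun G => ?_⟩, ?_⟩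
    · rw [lorentz_smul_left]; exact mul_nonpos_of_nonneg_of_nonpos hc.le (hle G)
    · rw [lorentz_smul_left, hwF, mul_zero]
  have hcont : ∀ G, Continuous fun s => lorentz (w s) (v G) := fun G => by
    simp only [hw]; fun_prop
  -- the last point of the segment that lies in the cone over the polyhedron
  obtain ⟨s, ⟨hs, hsle⟩, hmax⟩ :=
      (((isCompact_Icc (a := (0 : ℝ)) (b := 1)).inter_right (isClosed_iInter fun G =>
        isClosed_le (hcont G) continuous_const) :
        IsCompact (Set.Icc (0 : ℝ) 1 ∩ ⋂ G, {s | lorentz (w s) (v G) ≤ 0}))).exists_isGreatest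
      ⟨0, by simp, Set.mem_iInter.mpr fun G => by simpa [hw] using hpL G⟩
  have hsle' : ∀ G, lorentz (w s) (v G) ≤ 0 := fun G => Set.mem_iInter.mp hsle G
  have hs1 : s = 1 := by
    by_contra hne1
    have hlt : s < 1 := lt_of_le_of_ne hs.2 hne1
    have hev : ∀ G, ∀ᶠ r in 𝓝[>] s, r < 1 → lorentz (w r) (v G) ≤ 0 := by
      intro G
      by_cases hGF : G = F
      · subst hGF
        exact .of_forall fun r _ => (hwF r).le
      rcases hd G hGF with h | h
      · filter_upwards [self_mem_nhdsWithin] with r (hr : s < r) hr1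
        have h1 : lorentz z (v G) = lorentz y (v G) := by
          rw [hz, lorentz_sub_left, lorentz_smul_left, lorentz_comm (v F), h]; ring
        rw [hw, h1]
        nlinarith [hpL G, hy.2 G, hs.1]
      · -- the segment cannot meet a face that is disjoint from `F`
        have hneg : lorentz (w s) (v G) < 0 := by
          refine lt_of_le_of_ne (hsle' G) fun h0 => ?_
          obtain ⟨c, -, -, hc⟩ := hface s hs hsle'
          refine Set.disjoint_left.mp h hc ⟨hc.1, ?_⟩
          rw [lorentz_smul_left, h0, mul_zero]
        filter_upwards [nhdsWithin_le_nhds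
          ((hcont G).continuousAt.eventually_lt continuousAt_const hneg)] with r hr _
        exact hr.le
    obtain ⟨r, hr, hr1, hsr⟩ := ((eventually_all.mpr hev).and
      ((eventually_nhdsWithin_of_eventually_nhds (eventually_lt_nhds hlt)).and
        self_mem_nhdsWithin)).exists
    exact (hmax ⟨⟨hs.1.trans (le_of_lt hsr), hr1.le⟩,
      Set.mem_iInter.mpr fun G => hr G hr1⟩).not_gt hsr
  have hw1 : w s = z := by simp [w, hs1]
  obtain ⟨c, hc, hc1, hcF⟩ := hface s hs hsle'
  rw [hw1] at hc1 hcF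
  exact ⟨c, hc, by rw [hzz] at hc1; linarith, hcF⟩

theorem isCompact_polyhedronFace {ι : Type} {v : ι → Fin 4 → ℝ} (h : IsCompact (polyhedron v))
    (F : ι) : IsCompact (polyhedronFace v F) :=
  h.inter_right (isClosed_eq (continuous_lorentz.comp (continuous_id.prodMk continuous_const))
    continuous_const)

/-- If any two faces are orthogonal or disjoint, then two disjoint faces have a common perpendicular:
the segment of length `d` between points `x` and `y` of the faces, orthogonal to both. In particular
the two planes do not meet. -/
theorem exists_common_perpendicular {ι : Type} [Finite ι] {v : ι → Fin 4 → ℝ}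
    (hv : IsCompactPolyhedron v) {F G : ι}
    (hF : (polyhedronFace v F).Nonempty) (hG : (polyhedronFace v G).Nonempty)
    (hd : ∀ F G, F ≠ G → lorentz (v F) (v G) = 0 ∨
      Disjoint (polyhedronFace v F) (polyhedronFace v G))
    (hFG : Disjoint (polyhedronFace v F) (polyhedronFace v G)) :
    ∃ x ∈ polyhedronFace v F, ∃ y ∈ polyhedronFace v G, ∃ d : ℝ, 0 < d ∧
      y = Real.cosh d • x - Real.sinh d • v F ∧ v G = Real.sinh d • x - Real.cosh d • v F := by
  obtain ⟨⟨x, y⟩, ⟨hx, hy⟩, hmax⟩ :=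
    ((isCompact_polyhedronFace hv.compact F).prod
      (isCompact_polyhedronFace hv.compact G)).exists_isMaxOn (hF.prod hG)
      continuous_lorentz.continuousOn
  -- for a closest pair of points of two faces, each projects to the other
  have key : ∀ A B : ι, ∀ a ∈ polyhedronFace v A, ∀ b ∈ polyhedronFace v B,
      (∀ a' ∈ polyhedronFace v A, lorentz a' b ≤ lorentz a b) →
      b = √(1 + lorentz b (v A) ^ 2) • a + lorentz b (v A) • v A := by
    intro A B a ha b hb hmax
    obtain ⟨c, hc, hc1, hcA⟩ := exists_smul_sub_mem_polyhedronFace (hv.unit A) ⟨a, ha⟩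
      (fun G hG => (hd A G hG.symm).imp_left fun h => by rw [lorentz_comm, h]) hb.1
    set m := √(1 + lorentz b (v A) ^ 2) with hm
    have hm2 : m ^ 2 = 1 + lorentz b (v A) ^ 2 := Real.sq_sqrt (by positivity)
    have hmpos : 0 < m := Real.sqrt_pos.mpr (by positivity)
    have hcm : c * m = 1 := by
      have : (c * m) ^ 2 = 1 := by rw [mul_pow, hm2, hc1]
      nlinarith [mul_pos hc hmpos]
    have h1 := hmax _ hcA
    rw [lorentz_smul_left, lorentz_sub_left, lorentz_smul_left, hb.1.1.1, lorentz_comm (v A) b]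
      at h1
    have h2 : lorentz (c • (b - lorentz b (v A) • v A)) a = c * lorentz a b := by
      rw [lorentz_smul_left, lorentz_sub_left, lorentz_smul_left, lorentz_comm (v A) a, ha.2,
        lorentz_comm b]
      ring
    have h3 := eq_of_neg_one_le_lorentz hcA.1.1 ha.1.1 (by
      rw [h2]
      nlinarith)
    rw [← h3, smul_smul, mul_comm m c, hcm, one_smul, sub_add_cancel]
  have hy' := key F G x hx y hy fun a ha => hmax (Set.mk_mem_prod ha hy)
  have hx' := key G F y hy x hx fun b hb => by
    have := hmax (Set.mk_mem_prod hx hb)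
    rw [lorentz_comm b, lorentz_comm y]
    exact this
  have hneg : lorentz y (v F) < 0 :=
    lt_of_le_of_ne (hy.1.2 F) fun h => Set.disjoint_left.mp hFG ⟨hy.1, h⟩ hy
  have hneg' : lorentz x (v G) < 0 :=
    lt_of_le_of_ne (hx.1.2 G) fun h => Set.disjoint_left.mp hFG hx ⟨hx.1, h⟩
  have hsinh := Real.sinh_arsinh (-lorentz y (v F))
  have hcosh := Real.cosh_arsinh (-lorentz y (v F))
  have hpos : 0 < Real.arsinh (-lorentz y (v F)) := by rw [Real.arsinh_pos_iff]; linarith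
  refine ⟨x, hx, y, hy, Real.arsinh (-lorentz y (v F)), hpos, ?_, ?_⟩
  · rw [hsinh, hcosh, neg_sq, neg_smul, sub_neg_eq_add]
    exact hy'
  -- both square roots are equal to `-(x, y)`
  have hxy1 : lorentz x y = -√(1 + lorentz y (v F) ^ 2) := by
    conv_lhs => rw [hy']
    rw [lorentz_add_right, lorentz_smul_right, lorentz_smul_right, hx.1.1.1, hx.2]; ring
  have hxy2 : lorentz x y = -√(1 + lorentz x (v G) ^ 2) := by
    conv_lhs => rw [hx']
    rw [lorentz_add_left, lorentz_smul_left, lorentz_smul_left, hy.1.1.1,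
      lorentz_comm (v G), hy.2]; ring
  have hsq : √(1 + lorentz x (v G) ^ 2) = √(1 + lorentz y (v F) ^ 2) := by linarith
  have heq : lorentz x (v G) = lorentz y (v F) := by
    have := (Real.sqrt_inj (by positivity) (by positivity)).mp hsq
    nlinarith
  rw [hsinh, hcosh, neg_sq]
  rw [hsq, heq] at hx'
  have hC : √(1 + lorentz y (v F) ^ 2) ^ 2 = 1 + lorentz y (v F) ^ 2 :=
    Real.sq_sqrt (by positivity)
  generalize √(1 + lorentz y (v F) ^ 2) = C at *
  generalize lorentz y (v F) = S at *
  ext k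
  have e1 := congrFun hy' k
  have e2 := congrFun hx' k
  simp only [Pi.add_apply, Pi.smul_apply, Pi.sub_apply, smul_eq_mul] at e1 e2 ⊢
  have : S * v G k = S * (-S * x k - C * v F k) := by
    rw [e1] at e2
    linear_combination -e2 - x k * hC
  exact mul_left_cancel₀ hneg.ne this

/-! ### Translation lengths -/

/-- The translation by `s` along the geodesic through `x` with the unit tangent vector `t` at `x`,
which fixes the orthogonal complement of `x` and `t`. -/
noncomputable def hypTranslation (x t : Fin 4 → ℝ) (s : ℝ) (z : Fin 4 → ℝ) : Fin 4 → ℝ :=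
  z + (-lorentz z x * (Real.cosh s - 1) + lorentz z t * Real.sinh s) • x +
    (-lorentz z x * Real.sinh s + lorentz z t * (Real.cosh s - 1)) • t

theorem hypTranslation_add {x t : Fin 4 → ℝ} (hx : lorentz x x = -1) (ht : lorentz t t = 1)
    (hxt : lorentz x t = 0) (s r : ℝ) (z : Fin 4 → ℝ) :
    hypTranslation x t (s + r) z = hypTranslation x t s (hypTranslation x t r z) := by
  ext k
  simp only [hypTranslation, lorentz_add_left, lorentz_smul_left, hx, ht, hxt, lorentz_comm t x,
    Real.cosh_add, Real.sinh_add, Pi.add_apply, Pi.smul_apply, smul_eq_mul]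
  ring

/-- The product of the reflections in two planes at distance `d` is the translation by `2 d` along
their common perpendicular. -/
theorem linReflection_linReflection_eq_hypTranslation {x t b : Fin 4 → ℝ} (ht : lorentz t t = 1)
    (hb : lorentz b b = 1) (hxt : lorentz x t = 0) {d : ℝ}
    (hbd : b = Real.sinh d • x - Real.cosh d • t) (z : Fin 4 → ℝ) :
    linReflection t ht (linReflection b hb z) = hypTranslation x t (2 * d) z := by
  have hcs := Real.cosh_sq d
  ext k
  simp only [linReflection_apply, hypTranslation, hbd, lorentz_sub_left, lorentz_smul_left, ht, hxt,
    lorentz_sub_right, lorentz_smul_right, Real.cosh_two_mul, Real.sinh_two_mul, Pi.add_apply,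
    Pi.sub_apply, Pi.smul_apply, smul_eq_mul]
  generalize lorentz z x = a
  generalize lorentz z t = τ
  linear_combination (a * x k + τ * t k) * hcs

theorem neg_lorentz_hypTranslation {x t : Fin 4 → ℝ} {z : Fin 4 → ℝ} (hz : z ∈ Hyp3) (s : ℝ) :
    -lorentz z (hypTranslation x t s z) =
      1 + (lorentz z x ^ 2 - lorentz z t ^ 2) * (Real.cosh s - 1) := by
  simp only [hypTranslation, lorentz_add_right, lorentz_smul_right, hz.1]
  ring

theorem translationLength_of_eq_hypTranslation {x t : Fin 4 → ℝ} (hx : x ∈ Hyp3)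
    (ht : lorentz t t = 1) (hxt : lorentz x t = 0) {s : ℝ} (hs : 0 < s) {g : HypIsom}
    (hg : ∀ z, g.1 z = hypTranslation x t s z) : translationLength g = s ∧ IsLoxodromic g := by
  have hxs : hdist x (g.1 x) = s := by
    rw [hdist, hg, neg_lorentz_hypTranslation hx, hx.1, hxt]
    convert Real.arcosh_cosh hs.le using 2
    ring
  have hle : ∀ z : Hyp3, s ≤ hdist z (g.1 z) := by
    rintro ⟨z, hz⟩
    rw [← Real.arcosh_cosh hs.le, hdist, hg, neg_lorentz_hypTranslation hz]
    have h1 := lorentz_cauchySchwarz hx z t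
    rw [lorentz_comm t x, hxt, hz.1, ht] at h1
    have h2 := Real.one_le_cosh s
    have h3 : Real.cosh s ≤ 1 + (lorentz z x ^ 2 - lorentz z t ^ 2) * (Real.cosh s - 1) := by
      nlinarith
    exact (Real.arcosh_le_arcosh (by linarith) (by linarith)).mpr h3
  have hs' : translationLength g = s := by
    have : Nonempty Hyp3 := ⟨⟨x, hx⟩⟩
    refine le_antisymm ?_ (le_ciInf hle)
    rw [← hxs]
    exact ciInf_le (f := fun z : Hyp3 => hdist z (g.1 z))
      ⟨s, Set.forall_mem_range.mpr hle⟩ ⟨x, hx⟩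
  exact ⟨hs', by rw [hs']; exact hs, x, hx, by rw [hs', hxs]⟩

/-- If a group contains the reflections in two planes at distance `d`, then each of its subgroups of
finite index at most `D` has systole at most `2 D d`. -/
theorem systole_le_of_reflections {Λ Γ : Subgroup HypIsom} {D : ℕ} {x t b : Fin 4 → ℝ}
    (h0 : Λ.relIndex Γ ≠ 0) (hD : Λ.relIndex Γ ≤ D) (hx : x ∈ Hyp3) (ht : lorentz t t = 1)
    (hb : lorentz b b = 1) (htΓ : hypReflection t ht ∈ Γ) (hbΓ : hypReflection b hb ∈ Γ)
    (hxt : lorentz x t = 0) {d : ℝ} (hd : 0 < d)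
    (hbd : b = Real.sinh d • x - Real.cosh d • t) :
    systole Λ ≤ ENNReal.ofReal (D * (2 * d)) := by
  obtain ⟨k, hk0, hkD, hk⟩ :=
    Subgroup.exists_pow_mem_of_relIndex_ne_zero h0 (Γ.mul_mem htΓ hbΓ)
  set g := hypReflection t ht * hypReflection b hb with hg
  have hpow : ∀ (m : ℕ) z, (g ^ m).1 z = hypTranslation x t (m * (2 * d)) z := by
    intro m
    induction m with
    | zero => intro z; simp [hypTranslation]
    | succ m ih =>
      intro z
      rw [pow_succ, Nat.cast_add_one, add_mul, one_mul, hypTranslation_add hx.1 ht hxt, ← ih,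
        ← linReflection_linReflection_eq_hypTranslation ht hb hxt hbd]
      rfl
  obtain ⟨hl, hlox⟩ := translationLength_of_eq_hypTranslation hx ht hxt
    (mul_pos (Nat.cast_pos.mpr hk0) (mul_pos two_pos hd)) (hpow k)
  calc systole Λ ≤ ENNReal.ofReal (translationLength (g ^ k)) := iInf₂_le _ ⟨hk.1, hlox⟩
    _ ≤ ENNReal.ofReal (D * (2 * d)) := by
      rw [hl]
      refine ENNReal.ofReal_le_ofReal ?_
      have : (k : ℝ) ≤ D := Nat.cast_le.mpr (hkD.trans hD)
      gcongr

/-! ### Faces of Löbell polyhedra -/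

namespace LobellFace

instance {n : ℕ} [NeZero n] : Finite (LobellFace n) := by
  refine Finite.of_surjective (α := (Unit ⊕ Unit) ⊕ (ZMod n ⊕ ZMod n))
    (Sum.elim (Sum.elim (fun _ => top) (fun _ => bottom)) (Sum.elim upper lower)) ?_
  rintro (_ | _ | i | i)
  exacts [⟨.inl (.inl ()), rfl⟩, ⟨.inl (.inr ()), rfl⟩, ⟨.inr (.inl i), rfl⟩, ⟨.inr (.inr i), rfl⟩]

end LobellFace

theorem IsLobellVertex.encard_le {n : ℕ} {W : Set (LobellFace n)} (hW : IsLobellVertex n W) :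
    W.encard ≤ 3 := by
  have h : ∀ a b c : LobellFace n, ({a, b, c} : Set (LobellFace n)).encard ≤ 3 := fun a b c =>
    calc ({a, b, c} : Set (LobellFace n)).encard ≤ ({b, c} : Set (LobellFace n)).encard + 1 :=
          Set.encard_insert_le _ _
      _ ≤ 2 + 1 := by
        gcongr
        refine (Set.encard_insert_le _ _).trans ?_
        rw [Set.encard_singleton]
        norm_num
      _ = 3 := by norm_num
  cases hW <;> exact h _ _ _

namespace IsLobellPolyhedron

/-- Two faces that belong to two different vertices are orthogonal: they share two points. -/
theorem lorentz_eq_zero_of_vertices {n : ℕ} {v : LobellFace n → Fin 4 → ℝ}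
    (hv : IsLobellPolyhedron n v) {F G A B : LobellFace n} {W W' : Set (LobellFace n)}
    (hW : IsLobellVertex n W) (hW' : IsLobellVertex n W')
    (hsub : {F, G, A} ⊆ W) (hsub' : {F, G, B} ⊆ W')
    (hFG : F ≠ G) (hFA : F ≠ A) (hGA : G ≠ A) (hFB : F ≠ B) (hGB : G ≠ B) (hAB : A ≠ B) :
    lorentz (v F) (v G) = 0 := by
  obtain ⟨x, hx, hxF⟩ := (hv.hasLobellType _).mpr ⟨_, hW, hsub⟩
  obtain ⟨y, hy, hyF⟩ := (hv.hasLobellType _).mpr ⟨_, hW', hsub'⟩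
  refine hv.isRightAngled F G hFG ⟨x, ⟨hxF F (by simp), hxF G (by simp)⟩, y,
    ⟨hyF F (by simp), hyF G (by simp)⟩, ?_⟩
  rintro rfl
  -- otherwise four faces meet in one point
  obtain ⟨V, hV, hVsub⟩ := (hv.hasLobellType {F, G, A, B}).mp ⟨x, hx, by
    rintro H (rfl | rfl | rfl | rfl)
    exacts [hxF _ (by simp), hxF _ (by simp), hxF _ (by simp), hyF _ (by simp)]⟩
  have h4 : ({F, G, A, B} : Set (LobellFace n)).encard = 4 := by
    rw [Set.encard_insert_of_notMem (by simp [hFG, hFA, hFB]),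
      Set.encard_insert_of_notMem (by simp [hGA, hGB]), Set.encard_pair hAB]
    norm_num
  have h43 : (4 : ℕ∞) ≤ 3 := h4 ▸ (Set.encard_le_encard hVsub).trans hV.encard_le
  exact absurd h43 (by decide)

/-- Two faces of a Löbell polyhedron are orthogonal or disjoint. -/
theorem lorentz_eq_zero_or_disjoint {n : ℕ} {v : LobellFace n → Fin 4 → ℝ}
    (hv : IsLobellPolyhedron n v) (hn : 5 ≤ n) (F G : LobellFace n) (hFG : F ≠ G) :
    lorentz (v F) (v G) = 0 ∨ Disjoint (polyhedronFace v F) (polyhedronFace v G) := by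
  have one_ne : (1 : ZMod n) ≠ 0 := by
    have : Fact (1 < n) := ⟨by omega⟩
    exact one_ne_zero
  have two_ne : (1 + 1 : ZMod n) ≠ 0 := fun h => by
    have h2 := (ZMod.natCast_eq_zero_iff 2 n).mp (by push_cast; rw [← h]; norm_num)
    exact absurd (Nat.le_of_dvd two_pos h2) (by omega)
  have top_upper (i : ZMod n) : lorentz (v .top) (v (.upper i)) = 0 := by
    obtain ⟨j, rfl⟩ : ∃ j, i = j + 1 := ⟨i - 1, by ring⟩
    refine lorentz_eq_zero_of_vertices hv (A := .upper j) (B := .upper (j + 1 + 1)) (.top j)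
      (.top (j + 1)) ?_ ?_ ?_ ?_ ?_ ?_ ?_ ?_ <;>
    simp [Set.insert_subset_iff, add_assoc, one_ne, two_ne]
  have bottom_lower (i : ZMod n) : lorentz (v .bottom) (v (.lower i)) = 0 := by
    obtain ⟨j, rfl⟩ : ∃ j, i = j + 1 := ⟨i - 1, by ring⟩
    refine lorentz_eq_zero_of_vertices hv (A := .lower j) (B := .lower (j + 1 + 1)) (.bottom j)
      (.bottom (j + 1)) ?_ ?_ ?_ ?_ ?_ ?_ ?_ ?_ <;>
    simp [Set.insert_subset_iff, add_assoc, one_ne, two_ne]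
  have upper_upper (i : ZMod n) : lorentz (v (.upper i)) (v (.upper (i + 1))) = 0 := by
    refine lorentz_eq_zero_of_vertices hv (A := .top) (B := .lower (i + 1)) (.top i)
      (.upper i) ?_ ?_ ?_ ?_ ?_ ?_ ?_ ?_ <;>
    simp [Set.insert_subset_iff, one_ne]
  have lower_lower (i : ZMod n) : lorentz (v (.lower i)) (v (.lower (i + 1))) = 0 := by
    refine lorentz_eq_zero_of_vertices hv (A := .bottom) (B := .upper i) (.bottom i)
      (.lower i) ?_ ?_ ?_ ?_ ?_ ?_ ?_ ?_ <;>
    simp [Set.insert_subset_iff, one_ne]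
  have upper_lower_succ (i : ZMod n) : lorentz (v (.upper i)) (v (.lower (i + 1))) = 0 := by
    refine lorentz_eq_zero_of_vertices hv (A := .upper (i + 1)) (B := .lower i) (.upper i)
      (.lower i) ?_ ?_ ?_ ?_ ?_ ?_ ?_ ?_ <;>
    simp [Set.insert_subset_iff, one_ne]
  have upper_lower (i : ZMod n) : lorentz (v (.upper i)) (v (.lower i)) = 0 := by
    obtain ⟨j, rfl⟩ : ∃ j, i = j + 1 := ⟨i - 1, by ring⟩
    refine lorentz_eq_zero_of_vertices hv (A := .upper j) (B := .lower (j + 1 + 1)) (.upper j)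
      (.lower (j + 1)) ?_ ?_ ?_ ?_ ?_ ?_ ?_ ?_ <;>
    simp [Set.insert_subset_iff, one_ne]
  by_cases hdisj : Disjoint (polyhedronFace v F) (polyhedronFace v G)
  · exact .inr hdisj
  obtain ⟨x, hxF, hxG⟩ := Set.not_disjoint_iff.mp hdisj
  obtain ⟨W, hW, hsub⟩ := (hv.hasLobellType {F, G}).mp ⟨x, hxF.1, by
    rintro H (rfl | rfl)
    exacts [hxF, hxG]⟩
  have hF := hsub (Set.mem_insert F {G})
  have hG := hsub (Set.mem_insert_of_mem F (Set.mem_singleton G))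
  left
  cases hW <;> rcases hF with rfl | rfl | rfl <;> rcases hG with rfl | rfl | rfl <;>
    first
    | exact absurd rfl hFG
    | simp only [top_upper, bottom_lower, upper_upper, lower_lower, upper_lower_succ, upper_lower]
    | rw [lorentz_comm]
      simp only [top_upper, bottom_lower, upper_upper, lower_lower, upper_lower_succ, upper_lower]

theorem polyhedronFace_nonempty {n : ℕ} {v : LobellFace n → Fin 4 → ℝ}
    (hv : IsLobellPolyhedron n v) (F : LobellFace n) : (polyhedronFace v F).Nonempty := by
  have h : ∃ W, IsLobellVertex n W ∧ {F} ⊆ W := by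
    rcases F with _ | _ | i | i
    exacts [⟨_, .top 0, by simp⟩, ⟨_, .bottom 0, by simp⟩, ⟨_, .top i, by simp⟩,
      ⟨_, .bottom i, by simp⟩]
  obtain ⟨x, -, hx⟩ := (hv.hasLobellType {F}).mpr h
  exact ⟨x, hx F rfl⟩

theorem disjoint_top_bottom {n : ℕ} {v : LobellFace n → Fin 4 → ℝ}
    (hv : IsLobellPolyhedron n v) :
    Disjoint (polyhedronFace v .top) (polyhedronFace v .bottom) := by
  rw [Set.disjoint_left]
  intro x hx hx'
  obtain ⟨W, hW, hsub⟩ := (hv.hasLobellType {.top, .bottom}).mp ⟨x, hx.1, by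
    rintro H (rfl | rfl)
    exacts [hx, hx']⟩
  cases hW <;> simp [Set.insert_subset_iff] at hsub

theorem lorentz_nonpos {n : ℕ} {v : LobellFace n → Fin 4 → ℝ}
    (hv : IsLobellPolyhedron n v) (hn : 5 ≤ n) {F G : LobellFace n} (hFG : F ≠ G) :
    lorentz (v F) (v G) ≤ 0 := by
  have : NeZero n := ⟨by omega⟩
  rcases hv.lorentz_eq_zero_or_disjoint hn F G hFG with h | h
  · exact h.le
  obtain ⟨x, hx, y, hy, d, -, -, hG⟩ := exists_common_perpendicular hv.isCompactPolyhedron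
    (hv.polyhedronFace_nonempty F) (hv.polyhedronFace_nonempty G)
    (hv.lorentz_eq_zero_or_disjoint hn) h
  rw [hG, lorentz_sub_right, lorentz_smul_right, lorentz_smul_right, lorentz_comm (v F) x, hx.2,
    hv.isCompactPolyhedron.unit]
  linarith [Real.cosh_pos d]

end IsLobellPolyhedron

/-! ### The distance between top and bottom -/

/-- Let the planes with normals `t` and `b` have a common perpendicular of length `d` with feet `x`
and `y`. If two orthogonal planes with normals `u` and `w` are orthogonal to the plane of `t` and to
that of `b`, respectively, and far from `x` and `y`, then `d` is small. -/
theorem cosh_mul_sq_le {x y t b u w : Fin 4 → ℝ} {K d : ℝ} (hx : x ∈ Hyp3) (hy : y ∈ Hyp3)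
    (hd : 0 < d) (hxt : lorentz x t = 0)
    (hyx : y = Real.cosh d • x - Real.sinh d • t) (hbx : b = Real.sinh d • x - Real.cosh d • t)
    (hu : lorentz u u = 1) (hw : lorentz w w = 1) (hut : lorentz t u = 0) (hwb : lorentz b w = 0)
    (huw : lorentz u w = 0) (hK : 0 < K) (hux : lorentz x u < -K) (hwy : lorentz y w < -K) :
    Real.cosh d * K ^ 2 ≤ 1 + K ^ 2 := by
  have hch := Real.cosh_sq d
  have hC := Real.cosh_pos d
  have hS := Real.sinh_pos_iff.mpr hd
  -- replace `w` by its component orthogonal to `y`, which is also orthogonal to `x`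
  have hz := lorentz_cauchySchwarz hx u (w + lorentz y w • y)
  have hxy : lorentz y x = -Real.cosh d := by
    rw [hyx, lorentz_sub_left, lorentz_smul_left, lorentz_smul_left, hx.1, lorentz_comm t, hxt]
    ring
  have hwx : lorentz w x = Real.cosh d * lorentz y w := by
    rw [hbx, lorentz_sub_left, lorentz_smul_left, lorentz_smul_left] at hwb
    rw [hyx, lorentz_sub_left, lorentz_smul_left, lorentz_smul_left, lorentz_comm w]
    linear_combination -Real.sinh d * hwb - lorentz x w * hch
  have huy : lorentz u y = Real.cosh d * lorentz x u := by
    rw [hyx, lorentz_sub_right, lorentz_smul_right, lorentz_smul_right, lorentz_comm u t, hut,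
      lorentz_comm u x]
    ring
  have hzx : lorentz (w + lorentz y w • y) x = 0 := by
    rw [lorentz_add_left, lorentz_smul_left, hwx, hxy]; ring
  have hzz : lorentz (w + lorentz y w • y) (w + lorentz y w • y) = 1 + lorentz y w ^ 2 := by
    rw [lorentz_add_left, lorentz_add_right, lorentz_add_right, lorentz_smul_left,
      lorentz_smul_left, lorentz_smul_right, lorentz_smul_right, hw, hy.1, lorentz_comm w y]
    ring
  have hzu : lorentz u (w + lorentz y w • y) = Real.cosh d * lorentz x u * lorentz y w := by
    rw [lorentz_add_right, lorentz_smul_right, huw, huy]; ring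
  rw [hzx, hzz, hzu, hu, lorentz_comm u x] at hz
  generalize lorentz x u = A at hz hux
  generalize lorentz y w = B at hz hwy
  -- `hz` says that `(cosh d) ^ 2 ≤ (1 + A⁻²) (1 + B⁻²)`, where `A ^ 2` and `B ^ 2` exceed `K ^ 2`
  have hA : K ^ 2 < A ^ 2 := by nlinarith
  have hB : K ^ 2 < B ^ 2 := by nlinarith
  have hK2 : 0 < K ^ 2 := by positivity
  have hAK : (1 + A ^ 2) * K ^ 2 ≤ (1 + K ^ 2) * A ^ 2 := by nlinarith
  have hBK : (1 + B ^ 2) * K ^ 2 ≤ (1 + K ^ 2) * B ^ 2 := by nlinarith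
  have hprod := mul_le_mul hAK hBK (by positivity) (by positivity)
  have hAB : 0 < A ^ 2 * B ^ 2 := mul_pos (hK2.trans hA) (hK2.trans hB)
  refine le_of_sq_le_sq (le_of_mul_le_mul_right ?_ hAB) (by positivity)
  nlinarith [mul_le_mul_of_nonneg_right hz (sq_nonneg (K ^ 2))]

/-- The distance between the top and the bottom of a Löbell polyhedron with many faces is small. -/
theorem IsLobellPolyhedron.exists_common_perpendicular_lt {ε : ℝ} (hε : 0 < ε) :
    ∃ N : ℕ, ∀ n, N ≤ n → 5 ≤ n → ∀ v : LobellFace n → Fin 4 → ℝ, IsLobellPolyhedron n v →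
      ∃ x ∈ polyhedronFace v .top, ∃ d : ℝ, 0 < d ∧ d < ε ∧
        v .bottom = Real.sinh d • x - Real.cosh d • v .top := by
  have hcε : 1 < Real.cosh ε := Real.one_lt_cosh.mpr hε.ne'
  obtain ⟨K, hK0, hK⟩ : ∃ K : ℝ, 0 < K ∧ 1 + K ^ 2 < Real.cosh ε * K ^ 2 := by
    have hpos : 0 < 1 / (Real.cosh ε - 1) := one_div_pos.mpr (by linarith)
    refine ⟨√(1 / (Real.cosh ε - 1) + 1), by positivity, ?_⟩
    rw [Real.sq_sqrt (by positivity)]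
    have : (Real.cosh ε - 1) * (1 / (Real.cosh ε - 1)) = 1 :=
      mul_one_div_cancel (by linarith)
    nlinarith
  obtain ⟨N, hN⟩ := exists_card_le_of_lorentz_le K
  refine ⟨2 * N + 1, fun n hNn hn v hv => ?_⟩
  have : NeZero n := ⟨by omega⟩
  obtain ⟨x, hx, y, hy, d, hd, hyx, hbx⟩ := exists_common_perpendicular hv.isCompactPolyhedron
    (hv.polyhedronFace_nonempty _) (hv.polyhedronFace_nonempty _)
    (hv.lorentz_eq_zero_or_disjoint hn) hv.disjoint_top_bottom
  refine ⟨x, hx, d, hd, ?_, hbx⟩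
  -- at most `N` of the upper pentagons are near `x`, and at most `N` of the lower ones are near `y`
  have hcard : ∀ (f : ZMod n → LobellFace n), Function.Injective f → ∀ z ∈ Hyp3,
      (Finset.univ.filter fun i => |lorentz (v (f i)) z| ≤ K).card ≤ N := fun f hf z hz =>
    hN _ _ (fun i => v (f i)) z hz (fun i => hv.isCompactPolyhedron.unit _)
      (fun i j hij => hv.lorentz_nonpos hn (hf.ne hij)) fun i hi => (Finset.mem_filter.mp hi).2
  have hU := hcard .upper (fun i j h => by injection h) x hx.1.1
  have hW := hcard .lower (fun i j h => by injection h) y hy.1.1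
  obtain ⟨i, -, hi⟩ := Finset.exists_mem_notMem_of_card_lt_card
    (s := (Finset.univ.filter fun i => |lorentz (v (.upper i)) x| ≤ K) ∪
      Finset.univ.filter fun i => |lorentz (v (.lower i)) y| ≤ K) (t := Finset.univ) (by
      refine (Finset.card_union_le _ _).trans_lt ?_
      rw [Finset.card_univ, ZMod.card]
      omega)
  simp only [Finset.mem_union, Finset.mem_filter, Finset.mem_univ, true_and, not_or, not_le] at hi
  have hneg : ∀ F, ∀ z ∈ polyhedron v, K < |lorentz (v F) z| → lorentz z (v F) < -K := by
    intro F z hz h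
    rw [lorentz_comm, abs_of_nonpos (hz.2 F)] at h
    linarith
  have hmeet : ∀ F G, F ≠ G → (∃ W, IsLobellVertex n W ∧ {F, G} ⊆ W) →
      lorentz (v F) (v G) = 0 := by
    intro F G hFG hW
    obtain ⟨p, -, hp⟩ := (hv.hasLobellType {F, G}).mpr hW
    refine (hv.lorentz_eq_zero_or_disjoint hn F G hFG).resolve_right fun h => ?_
    exact Set.disjoint_left.mp h (hp F (by simp)) (hp G (by simp))
  have hle := cosh_mul_sq_le hx.1.1 hy.1.1 hd hx.2 hyx hbx (hv.isCompactPolyhedron.unit _)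
    (hv.isCompactPolyhedron.unit _)
    (hmeet .top (.upper i) (by simp) ⟨_, .top i, by simp [Set.insert_subset_iff]⟩)
    (hmeet .bottom (.lower i) (by simp) ⟨_, .bottom i, by simp [Set.insert_subset_iff]⟩)
    (hmeet (.upper i) (.lower i) (by simp) ⟨_, .lower i, by simp [Set.insert_subset_iff]⟩)
    hK0 (hneg _ x hx.1 hi.1) (hneg _ y hy.1 hi.2)
  have hlt : Real.cosh d < Real.cosh ε :=
    lt_of_mul_lt_mul_right (hle.trans_lt hK) (sq_nonneg K)
  rwa [Real.cosh_lt_cosh, abs_of_pos hd, abs_of_pos hε] at hlt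

theorem corollary1p3
    (v : (n : ℕ) → LobellFace n → Fin 4 → ℝ)
    (hv : ∀ n, 5 ≤ n → IsLobellPolyhedron n (v n))
    (Λ : ℕ → Subgroup HypIsom) (D : ℕ)
    (hΛ : ∀ n, 5 ≤ n → IsManifoldCoverOfDegreeLE (Λ n) (reflectionGroup (v n)) D) :
    Tendsto (fun n => systole (Λ n)) atTop (𝓝 0) := by
  have key : ∀ δ : ℝ, 0 < δ → ∀ᶠ n in atTop, systole (Λ n) ≤ ENNReal.ofReal δ := by
    intro δ hδ
    obtain ⟨N, hN⟩ := IsLobellPolyhedron.exists_common_perpendicular_lt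
      (ε := δ / (2 * (D + 1))) (by positivity)
    filter_upwards [eventually_ge_atTop N, eventually_ge_atTop 5] with n hNn hn
    obtain ⟨x, hx, d, hd, hdε, hb⟩ := hN n hNn hn (v n) (hv n hn)
    have hunit := (hv n hn).isCompactPolyhedron.unit
    have hmem : ∀ F, hypReflection (v n F) (hunit F) ∈ reflectionGroup (v n) := fun F =>
      Subgroup.subset_closure ⟨F, hunit F, rfl⟩
    refine (systole_le_of_reflections (hΛ n hn).finiteDegree (hΛ n hn).degree_le hx.1.1
      (hunit .top) (hunit .bottom) (hmem _) (hmem _) hx.2 hd hb).trans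
      (ENNReal.ofReal_le_ofReal ?_)
    rw [lt_div_iff₀ (by positivity)] at hdε
    nlinarith
  rw [ENNReal.tendsto_nhds_zero]
  intro ε hε
  obtain ⟨δ, hδ, hδε⟩ : ∃ δ : ℝ, 0 < δ ∧ ENNReal.ofReal δ ≤ ε := by
    rcases eq_or_ne ε ∞ with rfl | hε'
    · exact ⟨1, one_pos, le_top⟩
    · exact ⟨ε.toReal, ENNReal.toReal_pos hε.ne' hε', (ENNReal.ofReal_toReal hε').le⟩
  filter_upwards [key δ hδ] with n hn using hn.trans hδε
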